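/- Let $(\mathcal H,[\cdot,\cdot])$ be a Krein space, i.e. a complex vector space with a Hermitian sesquilinear form (linear in the first argument) that admits a fundamental decomposition: $\mathcal H=\mathcal H_+\dotplus\mathcal H_-$ is a direct, $[\cdot,\cdot]$-orthogonal sum of Hilbert spaces $(\mathcal H_+,[\cdot,\cdot])$ and $(\mathcal H_-,-[\cdot,\cdot])$. Such a decomposition is fixed, and $\mathcal H$ carries the induced Hilbert space inner product $\langle x_1+y_1,x_2+y_2\rangle=[x_1,x_2]-[y_1,y_2]$ ($x_i\in\mathcal H_+$, $y_i\in\mathcal H_-$), with norm $\|\cdot\|$. A subspace $\mathcal L$ is uniformly positive (negative) if there is $\alpha>0$ such that $[x,x]\ge\alpha\|x\|^2$ (respectively $-[x,x]\ge\alpha\|x\|^2$) for all $x\in\mathcal L$. Let $\mathcal F=\{f_i\}_{i\in I}$ be a Bessel family in $\mathcal H$, i.e. there is $\beta>0$ with $\sum_{i\in I}|\langle f,f_i\rangle|^2\le\beta\|f\|^2$ for all $f\in\mathcal H$, and put $I_+=\{i\in I:[f_i,f_i]\ge0\}$, $I_-=\{i\in I:[f_i,f_i]<0\}$. Suppose that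 $\mathcal F$ is a $J$-frame: with $T_\pm:\ell_2(I)\to\mathcal H$, $T_\pm x=\sum_{i\in I_\pm}x_if_i$, the range of $T_+$ is maximal among the uniformly positive subspaces of $\mathcal H$ and the range of $T_-$ is maximal among the uniformly negative subspaces. Let $S$ be the associated $J$-frame operator, $$Sf=\sum_{i\in I_+}[f,f_i]f_i-\sum_{i\in I_-}[f,f_i]f_i,\qquad f\in\mathcal H.$$ Then there exists a unique bounded linear operator $P$ on $\mathcal H$ that satisfies $P^2=S$ and $$\sigma(P)\subseteq\{re^{it}:\ r>0,\ t\in(-\tfrac{\pi}{4},\tfrac{\pi}{4})\}.$$ Moreover, this operator is self-adjoint in the Krein space, i.e. $[Px,y]=[x,Py]$ for all $x,y\in\mathcal H$. It is denoted by $S^{1/2}$. -/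

import Mathlib

open scoped InnerProductSpace ENNReal

noncomputable section

/-- `(Hp, Hm)` is a fundamental decomposition of the indefinite inner product `form` on `H`:
`H` is the direct and `form`-orthogonal sum of `Hp` and `Hm`, and the Hilbert space inner product
of `H` is the one induced by it, `⟨x₁ + y₁, x₂ + y₂⟩ = [x₁, x₂] - [y₁, y₂]` for `xᵢ ∈ Hp` and
`yᵢ ∈ Hm`. (Mathlib's `⟪u, v⟫_ℂ` is linear in `v`, hence the order of the arguments.) When `H` is
complete, this says that `(Hp, form)` and `(Hm, -form)` are Hilbert spaces. -/
structure IsFundamentalDecomposition {H : Type*} [NormedAddCommGroup H] [InnerProductSpace ℂ H]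
    (form : H →ₗ[ℂ] H →ₗ⋆[ℂ] ℂ) (Hp Hm : Submodule ℂ H) : Prop where
  isCompl : IsCompl Hp Hm
  form_orthogonal : ∀ x ∈ Hp, ∀ y ∈ Hm, form x y = 0
  inner_eq : ∀ x₁ ∈ Hp, ∀ x₂ ∈ Hp, ∀ y₁ ∈ Hm, ∀ y₂ ∈ Hm,
    ⟪x₂ + y₂, x₁ + y₁⟫_ℂ = form x₁ x₂ - form y₁ y₂

/-- A Krein space: a complex vector space with a Hermitian sesquilinear form `[x, y] = form x y`
(linear in `x`) that admits a fundamental decomposition. One such decomposition is used to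
equip `H` with its Hilbert space inner product, norm and topology. -/
structure KreinSpace (H : Type*) [NormedAddCommGroup H] [InnerProductSpace ℂ H]
    [CompleteSpace H] where
  form : H →ₗ[ℂ] H →ₗ⋆[ℂ] ℂ
  form_conj_symm : ∀ x y, starRingEnd ℂ (form y x) = form x y
  exists_fundamentalDecomposition :
    ∃ Hp Hm : Submodule ℂ H, IsFundamentalDecomposition form Hp Hm

/-- Bessel families: `∑ |⟨x, f i⟩|² ≤ β ‖x‖²` for all `x`. -/
def IsBesselFamily {H : Type*} [NormedAddCommGroup H] [InnerProductSpace ℂ H] {ι : Type*}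
    (f : ι → H) : Prop :=
  ∃ β : ℝ, 0 < β ∧ ∀ x : H, Summable (fun i => ‖⟪f i, x⟫_ℂ‖ ^ 2) ∧
    ∑' i, ‖⟪f i, x⟫_ℂ‖ ^ 2 ≤ β * ‖x‖ ^ 2

/-- The Hilbert space `ℓ₂(ι)` of complex families. -/
abbrev EllTwo (ι : Type*) : Type _ := lp (fun _ : ι => ℂ) 2

theorem EllTwo.memlp {ι : Type*} {a : ι → ℂ} (h : Summable (fun i => ‖a i‖ ^ 2)) :
    Memℓp a 2 := by
  refine (memℓp_gen_iff (by norm_num)).2 ?_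
  simpa using h

theorem EllTwo.norm_sq {ι : Type*} (x : EllTwo ι) : ‖x‖ ^ 2 = ∑' i, ‖x i‖ ^ 2 := by
  have h := lp.norm_rpow_eq_tsum (p := 2) (by norm_num) x
  simpa using h

theorem EllTwo.summable_sq {ι : Type*} (x : EllTwo ι) : Summable (fun i => ‖x i‖ ^ 2) := by
  have h := (lp.memℓp x).summable (by norm_num)
  simpa using h

/-- A linear map into the families on `ι` with `∑ |a x i|² ≤ β ‖x‖²`, as a bounded operator
into `ℓ₂(ι)`. -/
def EllTwo.ofBound {E : Type*} [NormedAddCommGroup E] [NormedSpace ℂ E] {ι : Type*}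
    (a : E →ₗ[ℂ] ι → ℂ)
    (h : ∃ β : ℝ, 0 < β ∧ ∀ x, Summable (fun i => ‖a x i‖ ^ 2) ∧
      ∑' i, ‖a x i‖ ^ 2 ≤ β * ‖x‖ ^ 2) : E →L[ℂ] EllTwo ι :=
  LinearMap.mkContinuousOfExistsBound
    { toFun := fun x => (⟨a x, EllTwo.memlp (h.choose_spec.2 x).1⟩ : EllTwo ι)
      map_add' := fun x y => by ext i; simp; rfl
      map_smul' := fun c x => by ext i; simp }
    (by
      obtain ⟨β, hβ, hb⟩ := h
      refine ⟨√β, fun x => ?_⟩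
      refine abs_le_of_sq_le_sq' ?_ (by positivity) |>.2
      rw [mul_pow, Real.sq_sqrt hβ.le, EllTwo.norm_sq]
      exact (hb x).2)

/-- The analysis operator `x ↦ (⟨x, f i⟩)ᵢ` of a Bessel family. -/
def analysisOperator {H : Type*} [NormedAddCommGroup H] [InnerProductSpace ℂ H] {ι : Type*}
    (f : ι → H) (hf : IsBesselFamily f) : H →L[ℂ] EllTwo ι :=
  EllTwo.ofBound (LinearMap.pi fun i => (innerSL ℂ (f i)).toLinearMap) hf

theorem hasSum_adjoint_analysisOperator {H : Type*} [NormedAddCommGroup H]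
    [InnerProductSpace ℂ H] [CompleteSpace H] {ι : Type*} (f : ι → H) (hf : IsBesselFamily f)
    (x : EllTwo ι) :
    HasSum (fun i => x i • f i)
      (ContinuousLinearMap.adjoint (analysisOperator f hf) x) := by
  classical
  have h := (lp.hasSum_single (p := 2) (by norm_num) x).mapL
    (ContinuousLinearMap.adjoint (analysisOperator f hf))
  convert h using 2 with i
  refine ext_inner_right ℂ fun y => ?_
  rw [ContinuousLinearMap.adjoint_inner_left, lp.inner_single_left, inner_smul_left]
  simp [analysisOperator, EllTwo.ofBound, mul_comm]

/-- The synthesis operator `T : ℓ₂(ι) → H`, `T x = ∑ xᵢ fᵢ`, of a Bessel family. -/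
def synthesisOperator {H : Type*} [NormedAddCommGroup H] [InnerProductSpace ℂ H]
    [CompleteSpace H] {ι : Type*} (f : ι → H) (hf : IsBesselFamily f) : EllTwo ι →L[ℂ] H :=
  (ContinuousLinearMap.adjoint (analysisOperator f hf)).copy (fun x => ∑' i, x i • f i)
    (funext fun x => (hasSum_adjoint_analysisOperator f hf x).tsum_eq)

/-- The orthogonal projection of `ℓ₂(ι)` onto `ℓ₂(s)`, for `s ⊆ ι`. -/
def EllTwo.proj {ι : Type*} (s : Set ι) : EllTwo ι →L[ℂ] EllTwo ι :=
  EllTwo.ofBound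
    { toFun := fun x => s.indicator (fun i => x i)
      map_add' := fun x y => by
        funext i; by_cases hi : i ∈ s <;> simp [hi]
      map_smul' := fun c x => by
        funext i; by_cases hi : i ∈ s <;> simp [hi] }
    (by
      refine ⟨1, one_pos, fun x => ?_⟩
      have hle : ∀ i, ‖s.indicator (fun i => x i) i‖ ^ 2 ≤ ‖x i‖ ^ 2 := fun i => by
        gcongr; exact norm_indicator_le_norm_self _ _
      have hs := EllTwo.summable_sq x
      have hs' := Summable.of_nonneg_of_le (fun i => by positivity) hle hs
      refine ⟨hs', ?_⟩
      rw [one_mul, EllTwo.norm_sq]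
      exact hs'.tsum_le_tsum hle hs)

namespace KreinSpace

variable {H : Type*} [NormedAddCommGroup H] [InnerProductSpace ℂ H] [CompleteSpace H]

/-- A bounded operator is self-adjoint in the Krein space. -/
def IsSelfAdjoint (K : KreinSpace H) (P : H →L[ℂ] H) : Prop :=
  ∀ x y, K.form (P x) y = K.form x (P y)

/-- Uniformly positive subspaces. -/
def IsUniformlyPositive (K : KreinSpace H) (L : Submodule ℂ H) : Prop :=
  ∃ α : ℝ, 0 < α ∧ ∀ x ∈ L, α * ‖x‖ ^ 2 ≤ (K.form x x).re

/-- Uniformly negative subspaces. -/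
def IsUniformlyNegative (K : KreinSpace H) (L : Submodule ℂ H) : Prop :=
  ∃ α : ℝ, 0 < α ∧ ∀ x ∈ L, α * ‖x‖ ^ 2 ≤ -(K.form x x).re

/-- The indices of the non-negative vectors of a family. -/
def indexPos (K : KreinSpace H) {ι : Type*} (f : ι → H) : Set ι :=
  {i | 0 ≤ (K.form (f i) (f i)).re}

/-- The indices of the negative vectors of a family. -/
def indexNeg (K : KreinSpace H) {ι : Type*} (f : ι → H) : Set ι :=
  {i | (K.form (f i) (f i)).re < 0}

/-- `J`-frames: Bessel families such that the range of `T₊ = T P₊` is a maximal uniformly positive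
subspace and the range of `T₋ = T P₋` is a maximal uniformly negative subspace. -/
structure IsJFrame (K : KreinSpace H) {ι : Type*} (f : ι → H) : Prop where
  bessel : IsBesselFamily f
  maximal_pos : Maximal K.IsUniformlyPositive
    (synthesisOperator f bessel ∘L EllTwo.proj (K.indexPos f)).range
  maximal_neg : Maximal K.IsUniformlyNegative
    (synthesisOperator f bessel ∘L EllTwo.proj (K.indexNeg f)).range

theorem exists_form_eq_inner (K : KreinSpace H) (x : H) :
    ∃ x' : H, ‖x'‖ ^ 2 = ‖x‖ ^ 2 ∧ ∀ y, K.form x y = ⟪y, x'⟫_ℂ := by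
  obtain ⟨Hp, Hm, hd⟩ := K.exists_fundamentalDecomposition
  have hsplit : ∀ z : H, ∃ u ∈ Hp, ∃ v ∈ Hm, u + v = z := fun z =>
    Submodule.mem_sup.1 (hd.isCompl.sup_eq_top ▸ Submodule.mem_top)
  obtain ⟨u, hu, v, hv, rfl⟩ := hsplit x
  have hnv := Hm.neg_mem hv
  refine ⟨u + -v, ?_, fun y => ?_⟩
  · have h1 := hd.inner_eq u hu u hu v hv v hv
    have h2 := hd.inner_eq u hu u hu _ hnv _ hnv
    rw [inner_self_eq_norm_sq_to_K] at h1 h2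
    simp only [map_neg, LinearMap.neg_apply, neg_neg] at h2
    rw [← h1] at h2
    exact_mod_cast h2
  · obtain ⟨p, hp, q, hq, rfl⟩ := hsplit y
    have h2 := hd.inner_eq u hu p hp _ hnv q hq
    have h3 := hd.form_orthogonal u hu q hq
    have h4 : K.form v p = 0 := by
      rw [← K.form_conj_symm, hd.form_orthogonal p hp v hv, map_zero]
    rw [h2]
    simp [h3, h4]

open Classical in
/-- The Krein space adjoint `T⁺ x = ∑_{i ∈ I₊} [x, f i] eᵢ - ∑_{i ∈ I₋} [x, f i] eᵢ` of the
synthesis operator, where `ℓ₂(ι)` carries the form `∑_{i ∈ I₊} xᵢ ȳᵢ - ∑_{i ∈ I₋} xᵢ ȳᵢ`. -/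
def synthesisAdjoint (K : KreinSpace H) {ι : Type*} (f : ι → H) (hf : IsBesselFamily f) :
    H →L[ℂ] EllTwo ι :=
  EllTwo.ofBound
    { toFun := fun x i => if i ∈ K.indexPos f then K.form x (f i) else -K.form x (f i)
      map_add' := fun x y => by
        funext i; by_cases hi : i ∈ K.indexPos f <;> simp [hi, add_comm]
      map_smul' := fun c x => by
        funext i; by_cases hi : i ∈ K.indexPos f <;> simp [hi] }
    (by
      obtain ⟨β, hβ, hb⟩ := hf
      refine ⟨β, hβ, fun x => ?_⟩
      obtain ⟨x', hn, hx'⟩ := K.exists_form_eq_inner x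
      have h := hb x'
      rw [hn] at h
      have he : ∀ i, ‖(if i ∈ K.indexPos f then K.form x (f i) else -K.form x (f i))‖ ^ 2
          = ‖⟪f i, x'⟫_ℂ‖ ^ 2 := fun i => by
        rw [← hx']; split_ifs <;> simp
      simpa only [LinearMap.coe_mk, AddHom.coe_mk, he] using h)

/-- The `J`-frame operator
`S x = T T⁺ x = ∑_{i ∈ I₊} [x, f i] f i - ∑_{i ∈ I₋} [x, f i] f i`. -/
def jFrameOperator (K : KreinSpace H) {ι : Type*} (f : ι → H) (hf : K.IsJFrame f) :
    H →L[ℂ] H :=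
  synthesisOperator f hf.bessel ∘L K.synthesisAdjoint f hf.bessel

end KreinSpace

/-- The open sector `{r e^{it} : r > 0, -π/4 < t < π/4}`. -/
def openSector : Set ℂ :=
  {z | ∃ r t : ℝ, 0 < r ∧ t ∈ Set.Ioo (-(Real.pi / 4)) (Real.pi / 4) ∧
    z = r * Complex.exp (t * Complex.I)}

end

/-!
The `J`-frame operator `S` is similar to a strictly accretive operator, and this puts its spectrum
into the open right half plane and produces the square root.

Let `T` be the synthesis operator, `F = T T*` the frame operator, and write
`F y = x₊ + x₋` with `x₊ = T P₊ T* y` and `x₋ = T P₋ T* y` in the ranges of `T₊` and `T₋`. Since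
`S = T (P₊ - P₋) T* J`, with `J` the fundamental symmetry,
`Re ⟨S F y, y⟩ = Re [F y, x₊ - x₋] = [x₊, x₊] - [x₋, x₋] ≥ α (‖x₊‖² + ‖x₋‖²) ≥ α / 2 ‖F y‖²`.
The maximality of the two ranges makes their sum the whole space
(`KreinSpace.sup_eq_top_of_maximal`), so `T` is surjective, `F` is positive and invertible, and
the estimate says that `F^{-1/2} S F^{1/2}` is strictly accretive
(`KreinSpace.exists_conj_jFrameOperator_accretive`).

For a strictly accretive operator `A` there is `r > 0` with `‖1 - r A‖ < 1`. In any Banach algebra,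
`‖1 - a‖ < 1` yields a root `b² = a` with `‖1 - b‖ < 1` by the contraction principle
(`exists_sq_eq_of_norm_one_sub_lt_one`). The spectrum of `b` and that of `b²` then lie in the right
half plane, which means that the spectrum of `b` lies in the sector. No holomorphic functional
calculus is needed.

Uniqueness: if `p² = q²`, then `x = p - q` solves the Sylvester equation `p x + x q = 0`, which has
only the trivial solution when the spectra of `p` and `q` lie in the right half plane
(`eq_zero_of_mul_add_mul_eq_zero`). Self-adjointness of the root `P` follows from uniqueness, as
its Krein space adjoint `J P* J` is another root of `S` with spectrum in the sector.
-/

/-! ### Sylvester equations and uniqueness of square roots -/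

open Filter Topology in
theorem tendsto_pow_atTop_nhds_zero_of_forall_mem_spectrum_norm_lt_one {A : Type*} [NormedRing A]
    [NormedAlgebra ℂ A] [CompleteSpace A] [Nontrivial A] {a : A}
    (h : ∀ z ∈ spectrum ℂ a, ‖z‖ < 1) : Tendsto (fun n : ℕ => a ^ n) atTop (𝓝 0) := by
  have hr : spectralRadius ℂ a < (1 : NNReal) :=
    spectrum.spectralRadius_lt_of_forall_lt a fun z hz => by exact_mod_cast h z hz
  obtain ⟨q, hq, hq1⟩ := ENNReal.lt_iff_exists_nnreal_btwn.1 hr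
  have hq1' : q < 1 := by exact_mod_cast hq1
  have hev := (spectrum.pow_nnnorm_pow_one_div_tendsto_nhds_spectralRadius a).eventually_lt_const hq
  have hq0 : Tendsto (fun n : ℕ => (q : ℝ) ^ n) atTop (𝓝 0) :=
    tendsto_pow_atTop_nhds_zero_of_lt_one q.coe_nonneg (by exact_mod_cast hq1')
  refine squeeze_zero_norm' ?_ hq0
  filter_upwards [hev, eventually_gt_atTop 0] with n hn hn0
  rw [one_div, ENNReal.rpow_inv_lt_iff (by positivity), ENNReal.rpow_natCast] at hn
  exact_mod_cast hn.le

/-- A compact subset of the open right half plane lies in an open disc tangent to the imaginary axis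
at the origin. -/
theorem exists_pos_forall_norm_sub_lt {s : Set ℂ} (hs : IsCompact s) (h : ∀ z ∈ s, 0 < z.re) :
    ∃ R : ℝ, 0 < R ∧ ∀ z ∈ s, ‖(R : ℂ) - z‖ < R := by
  have hc : ContinuousOn (fun z : ℂ => ‖z‖ ^ 2 / (2 * z.re)) s :=
    ContinuousOn.div (by fun_prop) (by fun_prop) fun z hz => by have := h z hz; positivity
  obtain ⟨M, hM⟩ := (hs.image_of_continuousOn hc).bddAbove
  refine ⟨|M| + 1, by positivity, fun z hz => ?_⟩
  have hz0 := h z hz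
  have h1 : ‖z‖ ^ 2 / (2 * z.re) < |M| + 1 :=
    ((hM ⟨z, hz, rfl⟩).trans (le_abs_self M)).trans_lt (lt_add_one _)
  rw [div_lt_iff₀ (by positivity)] at h1
  refine lt_of_pow_lt_pow_left₀ 2 (by positivity) ?_
  rw [← Complex.normSq_eq_norm_sq, Complex.normSq_apply] at h1 ⊢
  simp only [Complex.sub_re, Complex.ofReal_re, Complex.sub_im, Complex.ofReal_im]
  nlinarith

/-- The homogeneous Sylvester equation `p x + x q = 0` has only the trivial solution if the spectra
of `p` and `q` lie in the right half plane. For large `R` the equation reads `x = u x v⁻¹`, where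
`u = 1 - p / R` and `v⁻¹ = (1 + q / R)⁻¹` have spectral radius less than one; iterating it gives
`x = uⁿ x v⁻ⁿ → 0`. -/
theorem eq_zero_of_mul_add_mul_eq_zero {A : Type*} [NormedRing A] [NormedAlgebra ℂ A]
    [CompleteSpace A] [Nontrivial A] {p q x : A} (hp : ∀ z ∈ spectrum ℂ p, 0 < z.re)
    (hq : ∀ z ∈ spectrum ℂ q, 0 < z.re) (h : p * x + x * q = 0) : x = 0 := by
  obtain ⟨R, hR, hRp⟩ := exists_pos_forall_norm_sub_lt (spectrum.isCompact (𝕜 := ℂ) p) hp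
  have hR0 : (R : ℂ) ≠ 0 := by exact_mod_cast hR.ne'
  set r : ℂˣ := Units.mk0 (R : ℂ) hR0
  set u : A := r⁻¹ • (algebraMap ℂ A R - p) with hu
  have hup : ∀ z ∈ spectrum ℂ u, ‖z‖ < 1 := by
    intro z hz
    rw [hu, spectrum.unit_smul_eq_smul, ← spectrum.singleton_sub_eq] at hz
    obtain ⟨_, ⟨_, rfl, w, hw, rfl⟩, rfl⟩ := hz
    have := hRp w hw
    simp only [r, Units.val_inv_eq_inv_val, Units.val_mk0, smul_eq_mul, norm_mul,
      norm_inv, Complex.norm_real, Real.norm_eq_abs, abs_of_pos hR]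
    rw [inv_mul_lt_iff₀ hR]; simpa using this
  have hvu : IsUnit (r⁻¹ • (algebraMap ℂ A R + q)) := by
    rw [isUnit_smul_iff]
    have : -(R : ℂ) ∉ spectrum ℂ q := fun hm => by
      have := hq _ hm; simp at this; linarith
    rw [spectrum.notMem_iff] at this
    have he : algebraMap ℂ A R + q = -(algebraMap ℂ A (-(R : ℂ)) - q) := by rw [map_neg]; abel
    exact he ▸ this.neg
  obtain ⟨v, hv⟩ := hvu
  have hvq : ∀ z ∈ spectrum ℂ (↑v⁻¹ : A), ‖z‖ < 1 := by
    intro z hz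
    rw [← spectrum.map_inv, hv, spectrum.unit_smul_eq_smul, ← spectrum.singleton_add_eq] at hz
    obtain ⟨_, ⟨_, rfl, w, hw, rfl⟩, hz⟩ := hz
    have hw0 := hq w hw
    have h1 : 1 < ‖z⁻¹‖ := by
      rw [← hz]
      simp only [r, Units.val_inv_eq_inv_val, Units.val_mk0, smul_eq_mul, norm_mul,
        norm_inv, Complex.norm_real, Real.norm_eq_abs, abs_of_pos hR]
      rw [lt_inv_mul_iff₀ hR, mul_one]
      refine lt_of_lt_of_le ?_ (Complex.re_le_norm _)
      simpa using hw0
    rw [norm_inv] at h1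
    exact (one_lt_inv_iff₀.1 h1).2
  have hxv : x * v = u * x := by
    have hpx : p * x = -(x * q) := eq_neg_of_add_eq_zero_left h
    rw [hv, hu, mul_smul_comm, smul_mul_assoc, mul_add, sub_mul, hpx, sub_neg_eq_add,
      Algebra.commutes]
  have hx : x = u * x * ↑v⁻¹ := by rw [← hxv, mul_assoc, Units.mul_inv, mul_one]
  have hpow : ∀ n : ℕ, x = u ^ n * x * (↑v⁻¹ : A) ^ n := by
    intro n
    induction n with
    | zero => simp
    | succ n ih =>
      nth_rw 1 [ih, hx]
      simp only [pow_succ, pow_succ' (↑v⁻¹ : A), mul_assoc]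
  have ht := ((tendsto_pow_atTop_nhds_zero_of_forall_mem_spectrum_norm_lt_one hup).mul_const x).mul
    (tendsto_pow_atTop_nhds_zero_of_forall_mem_spectrum_norm_lt_one hvq)
  simp only [← hpow, zero_mul] at ht
  exact tendsto_nhds_unique tendsto_const_nhds ht

theorem eq_of_sq_eq_sq_of_spectrum_re_pos {A : Type*} [NormedRing A] [NormedAlgebra ℂ A]
    [CompleteSpace A] [Nontrivial A] {p q : A} (hp : ∀ z ∈ spectrum ℂ p, 0 < z.re)
    (hq : ∀ z ∈ spectrum ℂ q, 0 < z.re) (h : p ^ 2 = q ^ 2) : p = q := by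
  refine sub_eq_zero.1 (eq_zero_of_mul_add_mul_eq_zero hp hq ?_)
  have : p * (p - q) + (p - q) * q = p ^ 2 - q ^ 2 := by noncomm_ring
  rw [this, h, sub_self]

/-! ### Square roots near the identity -/

/-- With `c = 1 - a`, the root is `1 - x` for the fixed point `x` of the map `x ↦ (c + x²) / 2`,
which is a contraction of the closed ball of radius `‖c‖`. -/
theorem exists_sq_eq_of_norm_one_sub_lt_one {A : Type*} [NormedRing A] [NormedAlgebra ℂ A]
    [CompleteSpace A] {a : A} (h : ‖1 - a‖ < 1) : ∃ b : A, b ^ 2 = a ∧ ‖1 - b‖ < 1 := by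
  set c := 1 - a with hc
  set q : NNReal := ‖c‖₊
  have hq : (q : ℝ) < 1 := h
  set φ : A → A := fun x => (2⁻¹ : ℂ) • (c + x ^ 2) with hφ
  have hmaps : Set.MapsTo φ (Metric.closedBall 0 q) (Metric.closedBall 0 q) := by
    intro x hx
    rw [mem_closedBall_zero_iff] at hx ⊢
    have h1 : ‖c + x ^ 2‖ ≤ q + q ^ 2 := (norm_add_le _ _).trans
      (add_le_add le_rfl ((norm_pow_le' x two_pos).trans (by gcongr)))
    have h2 : ‖φ x‖ = 2⁻¹ * ‖c + x ^ 2‖ := by rw [hφ, norm_smul]; simp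
    nlinarith [q.coe_nonneg]
  have hcontr : ContractingWith q (hmaps.restrict φ _ _) := by
    refine ⟨by exact_mod_cast hq, LipschitzWith.of_dist_le_mul fun x y => ?_⟩
    obtain ⟨x, hx⟩ := x
    obtain ⟨y, hy⟩ := y
    rw [mem_closedBall_zero_iff] at hx hy
    simp only [Subtype.dist_eq, Set.MapsTo.val_restrict_apply, dist_eq_norm]
    have h1 : φ x - φ y = (2⁻¹ : ℂ) • (x * (x - y) + (x - y) * y) := by
      rw [hφ, ← smul_sub]; congr 1; noncomm_ring
    rw [h1, norm_smul]
    have h2 : ‖x * (x - y) + (x - y) * y‖ ≤ q * ‖x - y‖ + ‖x - y‖ * q :=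
      (norm_add_le _ _).trans (add_le_add ((norm_mul_le _ _).trans (by gcongr))
        ((norm_mul_le _ _).trans (by gcongr)))
    norm_num
    linarith
  obtain ⟨x, hx, hfix, -⟩ := ContractingWith.exists_fixedPoint' Metric.isClosed_closedBall.isComplete
    hmaps hcontr (x := 0) (by simp) (edist_ne_top _ _)
  refine ⟨1 - x, ?_, ?_⟩
  · have h1 : c + x ^ 2 = x + x := by
      have h2 : (2 : ℂ) • φ x = (2 : ℂ) • x := by rw [hfix]
      rwa [hφ, smul_inv_smul₀ two_ne_zero, two_smul] at h2
    have h3 : (1 - x) ^ 2 = 1 - (x + x) + x ^ 2 := by noncomm_ring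
    rw [h3, ← h1, hc]; abel
  · rw [mem_closedBall_zero_iff] at hx
    simpa using hx.trans_lt hq

theorem re_pos_of_mem_spectrum_of_norm_one_sub_lt_one {A : Type*} [NormedRing A]
    [NormedAlgebra ℂ A] [CompleteSpace A] [NormOneClass A] {a : A} (h : ‖1 - a‖ < 1) {z : ℂ}
    (hz : z ∈ spectrum ℂ a) : 0 < z.re := by
  have h1 : 1 - z ∈ spectrum ℂ (1 - a) := by
    have := spectrum.singleton_sub_eq a (1 : ℂ)
    rw [map_one] at this
    exact this ▸ ⟨1, rfl, z, hz, rfl⟩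
  have h2 := (Complex.re_le_norm _).trans_lt ((spectrum.norm_le_norm_of_mem h1).trans_lt h)
  simp at h2
  exact h2

/-! ### The sector -/

/-- The sector consists of the points `z` for which `z` and `z²` lie in the right half plane. -/
theorem mem_openSector_iff {z : ℂ} : z ∈ openSector ↔ 0 < z.re ∧ 0 < (z ^ 2).re := by
  have hpi := Real.pi_pos
  constructor
  · rintro ⟨r, t, hr, ⟨ht1, ht2⟩, rfl⟩
    have h2 : ((r : ℂ) * Complex.exp (t * Complex.I)) ^ 2
        = ((r ^ 2 : ℝ) : ℂ) * Complex.exp ((2 * t : ℝ) * Complex.I) := by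
      rw [mul_pow, ← Complex.exp_nat_mul]; push_cast; ring_nf
    rw [h2, Complex.re_ofReal_mul, Complex.re_ofReal_mul, Complex.exp_ofReal_mul_I_re,
      Complex.exp_ofReal_mul_I_re]
    exact ⟨mul_pos hr (Real.cos_pos_of_mem_Ioo ⟨by linarith, by linarith⟩),
      mul_pos (by positivity) (Real.cos_pos_of_mem_Ioo ⟨by linarith, by linarith⟩)⟩
  · rintro ⟨h1, h2⟩
    have hz : z ≠ 0 := fun h => by simp [h] at h1
    have ha := Complex.abs_arg_lt_pi_div_two_iff.2 (Or.inl h1)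
    have hpolar := Complex.norm_mul_exp_arg_mul_I z
    have h3 : z ^ 2 = ((‖z‖ ^ 2 : ℝ) : ℂ) * Complex.exp ((2 * z.arg : ℝ) * Complex.I) := by
      conv_lhs => rw [← hpolar]
      rw [mul_pow, ← Complex.exp_nat_mul]; push_cast; ring_nf
    rw [h3, Complex.re_ofReal_mul, Complex.exp_ofReal_mul_I_re] at h2
    have hcos := pos_of_mul_pos_right h2 (by positivity)
    rw [← Real.cos_abs] at hcos
    have hlt : |2 * z.arg| < Real.pi / 2 := by
      by_contra! hle
      rw [abs_mul, abs_two] at hle hcos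
      exact hcos.not_ge (Real.cos_nonpos_of_pi_div_two_le_of_le hle (by linarith))
    rw [abs_lt] at hlt
    exact ⟨‖z‖, z.arg, norm_pos_iff.2 hz, ⟨by linarith, by linarith⟩, hpolar.symm⟩

/-! ### Maximal uniformly definite subspaces -/

namespace KreinSpace

variable {H : Type*} [NormedAddCommGroup H] [InnerProductSpace ℂ H] [CompleteSpace H]

/-- The fundamental symmetry, that is, the Gram operator of the form with respect to the Hilbert
space inner product. -/
theorem exists_fundamentalSymmetry (K : KreinSpace H) :
    ∃ J : H →L[ℂ] H, _root_.IsSelfAdjoint J ∧ J * J = 1 ∧ ∀ x y, K.form x y = ⟪y, J x⟫_ℂ := by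
  choose J hn hJ using K.exists_form_eq_inner
  have hn' : ∀ x, ‖J x‖ = ‖x‖ := fun x => by
    simpa using congrArg Real.sqrt (hn x)
  let J' : H →ₗᵢ[ℂ] H :=
    { toFun := J
      map_add' := fun x y => ext_inner_left ℂ fun v => by
        rw [inner_add_right, ← hJ, ← hJ, ← hJ, map_add, LinearMap.add_apply]
      map_smul' := fun c x => ext_inner_left ℂ fun v => by
        simp [inner_smul_right, ← hJ]
      norm_map' := hn' }
  have hsa : ∀ x y, ⟪J x, y⟫_ℂ = ⟪x, J y⟫_ℂ := fun x y => by
    rw [← hJ, ← K.form_conj_symm, hJ, inner_conj_symm]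
  refine ⟨J'.toContinuousLinearMap,
    ContinuousLinearMap.isSelfAdjoint_iff_isSymmetric.2 hsa, ?_, hJ⟩
  ext x
  refine ext_inner_right ℂ fun y => ?_
  exact (hsa (J x) y).trans (J'.inner_map_map x y)

/-- The Krein space with the opposite form. It exchanges positive and negative subspaces. -/
instance : Neg (KreinSpace H) where
  neg K :=
    { form := -K.form
      form_conj_symm := fun x y => by simp [K.form_conj_symm]
      exists_fundamentalDecomposition := by
        obtain ⟨Hp, Hm, h⟩ := K.exists_fundamentalDecomposition
        refine ⟨Hm, Hp, h.isCompl.symm, fun x hx y hy => ?_, fun x₁ hx₁ x₂ hx₂ y₁ hy₁ y₂ hy₂ => ?_⟩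
        · rw [LinearMap.neg_apply, LinearMap.neg_apply, ← K.form_conj_symm,
            h.form_orthogonal y hy x hx, map_zero, neg_zero]
        · rw [add_comm x₂, add_comm x₁, h.inner_eq y₁ hy₁ y₂ hy₂ x₁ hx₁ x₂ hx₂]
          simp; ring }

theorem form_neg (K : KreinSpace H) (x y : H) : (-K).form x y = -K.form x y := rfl

theorem isUniformlyPositive_neg (K : KreinSpace H) :
    (-K).IsUniformlyPositive = K.IsUniformlyNegative := by
  funext L
  simp [IsUniformlyPositive, IsUniformlyNegative, form_neg]

variable {K : KreinSpace H}

theorem form_re_symm (K : KreinSpace H) (x y : H) : (K.form y x).re = (K.form x y).re := by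
  rw [← K.form_conj_symm x y, Complex.conj_re]

theorem form_self_add_smul_re (K : KreinSpace H) (x y : H) (c : ℂ) :
    (K.form (x + c • y) (x + c • y)).re
      = (K.form x x).re + 2 * (c * K.form y x).re + ‖c‖ ^ 2 * (K.form y y).re := by
  have h1 := K.form_re_symm (c • y) x
  have h2 : starRingEnd ℂ c * (c * K.form y y) = ((‖c‖ ^ 2 : ℝ) : ℂ) * K.form y y := by
    rw [← mul_assoc, Complex.conj_mul']; norm_cast
  simp only [map_add, LinearMap.add_apply, map_smul, LinearMap.smul_apply, smul_eq_mul,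
    LinearMap.map_smulₛₗ, mul_add, Complex.add_re] at h1 ⊢
  rw [h2, Complex.re_ofReal_mul]
  linarith

theorem isClosed_of_maximal {L : Submodule ℂ H} (hL : Maximal K.IsUniformlyPositive L) :
    IsClosed (L : Set H) := by
  obtain ⟨J, -, -, hJ⟩ := K.exists_fundamentalSymmetry
  obtain ⟨α, hα, h⟩ := hL.prop
  have hcl : K.IsUniformlyPositive L.topologicalClosure := by
    refine ⟨α, hα, fun x hx => ?_⟩
    -- Positivity with a fixed constant is a closed condition.
    have hset : IsClosed {x : H | α * ‖x‖ ^ 2 ≤ (⟪x, J x⟫_ℂ).re} :=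
      isClosed_le (by fun_prop) (by fun_prop)
    rw [hJ]
    exact closure_minimal (fun y hy => by simpa [← hJ] using h y hy) hset hx
  rw [hL.eq_of_le hcl L.le_topologicalClosure]
  exact L.isClosed_topologicalClosure

/-- Otherwise `L ⊔ ℂ ∙ w` would be a larger uniformly positive subspace. -/
theorem form_self_re_nonpos_of_orthogonal {L : Submodule ℂ H}
    (hL : Maximal K.IsUniformlyPositive L) {w : H} (hw : ∀ l ∈ L, K.form w l = 0) :
    (K.form w w).re ≤ 0 := by
  obtain ⟨α, hα, h⟩ := hL.prop
  by_contra! hpos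
  set δ := (K.form w w).re
  have hw0 : 0 < ‖w‖ := norm_pos_iff.2 fun h0 => by simp [δ, h0] at hpos
  have hsup : K.IsUniformlyPositive (L ⊔ ℂ ∙ w) := by
    refine ⟨min α (δ / ‖w‖ ^ 2) / 2, by positivity, fun x hx => ?_⟩
    obtain ⟨l, hl, _, hc, rfl⟩ := Submodule.mem_sup.1 hx
    obtain ⟨c, rfl⟩ := Submodule.mem_span_singleton.1 hc
    rw [form_self_add_smul_re, hw l hl]
    have h1 : ‖l + c • w‖ ^ 2 ≤ 2 * (‖l‖ ^ 2 + ‖c‖ ^ 2 * ‖w‖ ^ 2) := by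
      rw [← mul_pow, ← norm_smul]
      exact (pow_le_pow_left₀ (norm_nonneg _) (norm_add_le _ _) 2).trans add_sq_le
    have h2 : min α (δ / ‖w‖ ^ 2) * ‖l‖ ^ 2 ≤ (K.form l l).re :=
      (mul_le_mul_of_nonneg_right (min_le_left _ _) (by positivity)).trans (h l hl)
    have h3 : min α (δ / ‖w‖ ^ 2) * ‖w‖ ^ 2 ≤ δ := by
      rw [← le_div_iff₀ (by positivity)]; exact min_le_right _ _
    have h4 := mul_le_mul_of_nonneg_left h3 (sq_nonneg ‖c‖)
    have h5 : 0 < min α (δ / ‖w‖ ^ 2) := by positivity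
    have h6 := mul_le_mul_of_nonneg_left h1 h5.le
    simp only [mul_zero, Complex.zero_re, add_zero]
    linarith
  have hwL : w ∈ L := by
    rw [hL.eq_of_le hsup le_sup_left]
    exact Submodule.mem_sup_right (Submodule.mem_span_singleton_self w)
  simp [δ, hw w hwL] at hpos

/-- The orthogonal companion of a maximal uniformly positive subspace `L` is negative definite: a
neutral vector in it is isotropic there, so it belongs to the double companion of `L`, which is the
closed subspace `L` itself. -/
theorem eq_zero_of_orthogonal_of_form_self_re_nonneg {L : Submodule ℂ H}
    (hL : Maximal K.IsUniformlyPositive L) {w : H} (hw : ∀ l ∈ L, K.form w l = 0)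
    (hww : 0 ≤ (K.form w w).re) : w = 0 := by
  obtain ⟨J, hJsa, hJJ, hJ⟩ := K.exists_fundamentalSymmetry
  have hJJ' : ∀ x, J (J x) = x := fun x => congrArg (fun B : H →L[ℂ] H => B x) hJJ
  have hw0 := le_antisymm (form_self_re_nonpos_of_orthogonal hL hw) hww
  -- The form is nonpositive on the orthogonal companion of `L`, where the neutral vector `w` is
  -- therefore isotropic.
  have hiso : ∀ u, (∀ l ∈ L, K.form u l = 0) → K.form u w = 0 := by
    intro u hu
    by_contra ha
    set a := K.form u w
    set s : ℝ := (1 + |(K.form u u).re|)⁻¹ with hs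
    have h1 := form_self_re_nonpos_of_orthogonal hL (w := w + ((s : ℂ) * starRingEnd ℂ a) • u)
      fun l hl => by simp [hw l hl, hu l hl]
    have h2 : ((s : ℂ) * starRingEnd ℂ a * a).re = s * ‖a‖ ^ 2 := by
      rw [mul_assoc, mul_comm (starRingEnd ℂ a), Complex.mul_conj']; norm_cast
    rw [form_self_add_smul_re, hw0, h2, norm_mul, RCLike.norm_conj, Complex.norm_real,
      Real.norm_eq_abs, mul_pow, sq_abs] at h1
    have hs0 : 0 < s := by positivity
    have hpos : 0 < s * ‖a‖ ^ 2 := by have := norm_pos_iff.2 ha; positivity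
    have h3 : s * (K.form u u).re > -1 := by
      have h4 : s * (1 + |(K.form u u).re|) = 1 := inv_mul_cancel₀ (by positivity)
      nlinarith [neg_abs_le (K.form u u).re]
    nlinarith
  have hwL : w ∈ L := by
    have := (isClosed_of_maximal hL).completeSpace_coe
    rw [← L.orthogonal_orthogonal, Submodule.mem_orthogonal]
    intro v hv
    have := hiso (J v) fun l hl => by rw [hJ, hJJ', hv l hl]
    rwa [hJ, hJJ', inner_eq_zero_symm] at this
  obtain ⟨α, hα, h⟩ := hL.prop
  have := h w hwL
  rw [hw0] at this
  have : ‖w‖ ^ 2 ≤ 0 := nonpos_of_mul_nonpos_right this hα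
  simpa using this

theorem form_add_sub_re (K : KreinSpace H) (x y : H) :
    (K.form (x + y) (x - y)).re = (K.form x x).re - (K.form y y).re := by
  have := K.form_re_symm x y
  simp only [map_add, map_sub, LinearMap.add_apply, Complex.add_re, Complex.sub_re]
  linarith

/-- The estimate `[x + y, x - y] ≥ α (‖x‖² + ‖y‖²)`. It shows that the sum of the two subspaces is
closed, and that the `J`-frame operator is accretive up to similarity. -/
theorem le_form_add_sub_re {L M : Submodule ℂ H} (hL : K.IsUniformlyPositive L)
    (hM : K.IsUniformlyNegative M) : ∃ α : ℝ, 0 < α ∧ ∀ x ∈ L, ∀ y ∈ M,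
      α * (‖x‖ ^ 2 + ‖y‖ ^ 2) ≤ (K.form (x + y) (x - y)).re := by
  obtain ⟨α, hα, hL⟩ := hL
  obtain ⟨β, hβ, hM⟩ := hM
  refine ⟨min α β, lt_min hα hβ, fun x hx y hy => ?_⟩
  rw [form_add_sub_re]
  have h1 := (mul_le_mul_of_nonneg_right (min_le_left α β) (sq_nonneg ‖x‖)).trans (hL x hx)
  have h2 := (mul_le_mul_of_nonneg_right (min_le_right α β) (sq_nonneg ‖y‖)).trans (hM y hy)
  linarith

theorem isClosed_sup {L M : Submodule ℂ H} (hL : Maximal K.IsUniformlyPositive L)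
    (hM : Maximal K.IsUniformlyNegative M) : IsClosed ((L ⊔ M : Submodule ℂ H) : Set H) := by
  have := (isClosed_of_maximal hL).completeSpace_coe
  have := (isClosed_of_maximal (K.isUniformlyPositive_neg.symm ▸ hM)).completeSpace_coe
  obtain ⟨α, hα, h⟩ := le_form_add_sub_re hL.prop hM.prop
  let D : L × M →L[ℂ] H := L.subtypeL.coprod M.subtypeL
  have hD : AntilipschitzWith (Real.toNNReal (2 / α)) D := by
    refine D.antilipschitz_of_bound fun p => ?_
    obtain ⟨⟨x, hx⟩, ⟨y, hy⟩⟩ := p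
    rw [Real.coe_toNNReal _ (by positivity)]
    have h1 := h x hx y hy
    have h2 : (K.form (x + y) (x - y)).re ≤ ‖x + y‖ * (‖x‖ + ‖y‖) := by
      obtain ⟨z, hz, hform⟩ := K.exists_form_eq_inner (x + y)
      rw [hform]
      have hz' : ‖z‖ = ‖x + y‖ := by simpa using congrArg Real.sqrt hz
      refine (Complex.re_le_norm _).trans ((norm_inner_le_norm _ _).trans ?_)
      rw [hz', mul_comm]
      gcongr
      exact norm_sub_le _ _
    have h3 : α * (‖x‖ + ‖y‖) ≤ 2 * ‖x + y‖ := by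
      rcases (add_nonneg (norm_nonneg x) (norm_nonneg y)).eq_or_lt with h0 | h0
      · rw [← h0, mul_zero]; positivity
      · refine le_of_mul_le_mul_right ?_ h0
        nlinarith [sq_nonneg (‖x‖ - ‖y‖)]
    have h4 : ‖((⟨x, hx⟩, ⟨y, hy⟩) : L × M)‖ ≤ ‖x‖ + ‖y‖ :=
      max_le (le_add_of_nonneg_right (norm_nonneg _)) (le_add_of_nonneg_left (norm_nonneg _))
    refine h4.trans ?_
    change ‖x‖ + ‖y‖ ≤ 2 / α * ‖x + y‖
    rw [div_mul_eq_mul_div, le_div_iff₀ hα]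
    linarith
  have hr : ((L ⊔ M : Submodule ℂ H) : Set H) = Set.range D := by
    ext z
    simp [D, Submodule.mem_sup]
  rw [hr]
  exact hD.isClosed_range D.uniformContinuous

/-- The sum is closed, and a vector orthogonal to `L` and to `M` with respect to the form is at once
nonnegative, by the maximality of `M`, and in the negative definite companion of `L`. -/
theorem sup_eq_top_of_maximal {L M : Submodule ℂ H} (hL : Maximal K.IsUniformlyPositive L)
    (hM : Maximal K.IsUniformlyNegative M) : L ⊔ M = ⊤ := by
  have := (isClosed_sup hL hM).completeSpace_coe
  rw [← Submodule.orthogonal_eq_bot_iff, Submodule.eq_bot_iff]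
  intro z hz
  obtain ⟨J, hJsa, hJJ, hJ⟩ := K.exists_fundamentalSymmetry
  have hJJ' : ∀ x, J (J x) = x := fun x => congrArg (fun B : H →L[ℂ] H => B x) hJJ
  have horth : ∀ l ∈ L ⊔ M, K.form (J z) l = 0 := fun l hl => by rw [hJ, hJJ', hz l hl]
  have hM' : Maximal (-K).IsUniformlyPositive M := K.isUniformlyPositive_neg.symm ▸ hM
  have h0 : 0 ≤ (K.form (J z) (J z)).re := by
    have := form_self_re_nonpos_of_orthogonal hM' (w := J z) fun l hl => by
      rw [form_neg, horth l (Submodule.mem_sup_right hl), neg_zero]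
    simpa [form_neg] using this
  have h1 := eq_zero_of_orthogonal_of_form_self_re_nonneg hL
    (fun l hl => horth l (Submodule.mem_sup_left hl)) h0
  rw [← hJJ' z, h1, map_zero]

end KreinSpace

/-! ### The `J`-frame operator -/

theorem EllTwo.isSelfAdjoint_proj {ι : Type*} (s : Set ι) : IsSelfAdjoint (EllTwo.proj s) := by
  refine ContinuousLinearMap.isSelfAdjoint_iff_isSymmetric.2 fun x y => ?_
  rw [lp.inner_eq_tsum, lp.inner_eq_tsum]
  refine tsum_congr fun i => ?_
  change ⟪s.indicator (fun i => x i) i, y i⟫_ℂ = ⟪x i, s.indicator (fun i => y i) i⟫_ℂ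
  by_cases hi : i ∈ s <;> simp [hi]

theorem synthesisOperator_eq_adjoint {H : Type*} [NormedAddCommGroup H] [InnerProductSpace ℂ H]
    [CompleteSpace H] {ι : Type*} (f : ι → H) (hf : IsBesselFamily f) :
    synthesisOperator f hf = ContinuousLinearMap.adjoint (analysisOperator f hf) :=
  ContinuousLinearMap.copy_eq _ _ _

namespace KreinSpace

variable {H : Type*} [NormedAddCommGroup H] [InnerProductSpace ℂ H] [CompleteSpace H]
  {K : KreinSpace H} {ι : Type*} {f : ι → H}

theorem proj_indexPos_add_proj_indexNeg (K : KreinSpace H) (f : ι → H) (a : EllTwo ι) :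
    EllTwo.proj (K.indexPos f) a + EllTwo.proj (K.indexNeg f) a = a := by
  ext i
  change (K.indexPos f).indicator (fun i => a i) i + (K.indexNeg f).indicator (fun i => a i) i = a i
  rcases le_or_gt 0 (K.form (f i) (f i)).re with h | h
  · rw [Set.indicator_of_mem (show i ∈ K.indexPos f from h),
      Set.indicator_of_notMem (show i ∉ K.indexNeg f from h.not_gt), add_zero]
  · rw [Set.indicator_of_notMem (show i ∉ K.indexPos f from h.not_ge),
      Set.indicator_of_mem (show i ∈ K.indexNeg f from h), zero_add]

/-- The Krein space adjoint of the synthesis operator `T` is `(P₊ - P₋) T* J`. -/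
theorem synthesisAdjoint_eq (hf : IsBesselFamily f) {J : H →L[ℂ] H}
    (hJ : ∀ x y, K.form x y = ⟪y, J x⟫_ℂ) (x : H) :
    K.synthesisAdjoint f hf x = EllTwo.proj (K.indexPos f) (analysisOperator f hf (J x))
      - EllTwo.proj (K.indexNeg f) (analysisOperator f hf (J x)) := by
  classical
  ext i
  change (if i ∈ K.indexPos f then K.form x (f i) else -K.form x (f i))
    = (K.indexPos f).indicator (fun i => ⟪f i, J x⟫_ℂ) i
      - (K.indexNeg f).indicator (fun i => ⟪f i, J x⟫_ℂ) i
  rcases le_or_gt 0 (K.form (f i) (f i)).re with h | h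
  · rw [if_pos (show i ∈ K.indexPos f from h),
      Set.indicator_of_mem (show i ∈ K.indexPos f from h),
      Set.indicator_of_notMem (show i ∉ K.indexNeg f from h.not_gt), sub_zero, hJ]
  · rw [if_neg (show i ∉ K.indexPos f from h.not_ge),
      Set.indicator_of_notMem (show i ∉ K.indexPos f from h.not_ge),
      Set.indicator_of_mem (show i ∈ K.indexNeg f from h), zero_sub, hJ]

/-- The identity `⟨S x, y⟩ = [x, T (P₊ - P₋) T* y]`. -/
theorem inner_jFrameOperator (hf : K.IsJFrame f) (x y : H) :
    ⟪y, K.jFrameOperator f hf x⟫_ℂ = K.form x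
      (synthesisOperator f hf.bessel
          (EllTwo.proj (K.indexPos f) (analysisOperator f hf.bessel y))
        - synthesisOperator f hf.bessel
          (EllTwo.proj (K.indexNeg f) (analysisOperator f hf.bessel y))) := by
  obtain ⟨J, -, -, hJ⟩ := K.exists_fundamentalSymmetry
  have hp := (EllTwo.isSelfAdjoint_proj (K.indexPos f)).isSymmetric
  have hm := (EllTwo.isSelfAdjoint_proj (K.indexNeg f)).isSymmetric
  change ⟪y, synthesisOperator f hf.bessel (K.synthesisAdjoint f hf.bessel x)⟫_ℂ = _
  rw [hJ, synthesisAdjoint_eq hf.bessel hJ, ← map_sub, synthesisOperator_eq_adjoint,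
    ContinuousLinearMap.adjoint_inner_right, ContinuousLinearMap.adjoint_inner_left,
    inner_sub_left, inner_sub_right]
  exact congrArg₂ _ (hp _ _).symm (hm _ _).symm

theorem isSelfAdjoint_jFrameOperator (hf : K.IsJFrame f) :
    K.IsSelfAdjoint (K.jFrameOperator f hf) := by
  obtain ⟨J, hJsa, -, hJ⟩ := K.exists_fundamentalSymmetry
  have hp := (EllTwo.isSelfAdjoint_proj (K.indexPos f)).isSymmetric
  have hm := (EllTwo.isSelfAdjoint_proj (K.indexNeg f)).isSymmetric
  intro x y
  have h1 : ∀ x y, K.form x (K.jFrameOperator f hf y)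
      = ⟪K.synthesisAdjoint f hf.bessel y, analysisOperator f hf.bessel (J x)⟫_ℂ := fun x y => by
    rw [hJ]
    change ⟪synthesisOperator f hf.bessel (K.synthesisAdjoint f hf.bessel y), _⟫_ℂ = _
    rw [synthesisOperator_eq_adjoint, ContinuousLinearMap.adjoint_inner_left]
  rw [← K.form_conj_symm, h1, h1, inner_conj_symm, synthesisAdjoint_eq hf.bessel hJ,
    synthesisAdjoint_eq hf.bessel hJ, inner_sub_left, inner_sub_right]
  exact congrArg₂ _ (hp _ _).symm (hm _ _).symm

theorem synthesisOperator_surjective (hf : K.IsJFrame f) :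
    Function.Surjective (synthesisOperator f hf.bessel) := by
  intro z
  have hz : z ∈ (⊤ : Submodule ℂ H) := Submodule.mem_top
  rw [← sup_eq_top_of_maximal hf.maximal_pos hf.maximal_neg] at hz
  obtain ⟨_, ⟨a, rfl⟩, _, ⟨b, rfl⟩, rfl⟩ := Submodule.mem_sup.1 hz
  exact ⟨_, map_add _ _ _⟩

/-- The analysis operator, adjoint to the surjective synthesis operator, is bounded below, by the
open mapping theorem. -/
theorem exists_norm_le_norm_analysisOperator (hf : K.IsJFrame f) :
    ∃ C : ℝ, 0 < C ∧ ∀ x, ‖x‖ ≤ C * ‖analysisOperator f hf.bessel x‖ := by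
  obtain ⟨C, hC, h⟩ := (synthesisOperator f hf.bessel).exists_preimage_norm_le
    (synthesisOperator_surjective hf)
  refine ⟨C, hC, fun x => ?_⟩
  obtain ⟨a, rfl, ha⟩ := h x
  set x := synthesisOperator f hf.bessel a with hx
  rcases (norm_nonneg x).eq_or_lt with h0 | h0
  · rw [← h0]; positivity
  refine le_of_mul_le_mul_right ?_ h0
  calc ‖x‖ * ‖x‖ = ‖⟪x, x⟫_ℂ‖ := by rw [inner_self_eq_norm_sq_to_K]; simp [pow_two]
    _ = ‖⟪a, analysisOperator f hf.bessel x⟫_ℂ‖ := by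
      nth_rw 1 [hx]
      rw [synthesisOperator_eq_adjoint, ContinuousLinearMap.adjoint_inner_left]
    _ ≤ ‖a‖ * ‖analysisOperator f hf.bessel x‖ := norm_inner_le_norm _ _
    _ ≤ C * ‖x‖ * ‖analysisOperator f hf.bessel x‖ := by gcongr
    _ = C * ‖analysisOperator f hf.bessel x‖ * ‖x‖ := by ring

/-- The frame operator `F = T T*` is the square of an invertible self-adjoint operator. -/
theorem exists_isUnit_frameOperator_eq_mul_self (hf : K.IsJFrame f) :
    ∃ b : (H →L[ℂ] H)ˣ, _root_.IsSelfAdjoint (b : H →L[ℂ] H) ∧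
      synthesisOperator f hf.bessel ∘L analysisOperator f hf.bessel = b * b := by
  set F : H →L[ℂ] H := synthesisOperator f hf.bessel ∘L analysisOperator f hf.bessel with hF
  have hF' : F = ContinuousLinearMap.adjoint (analysisOperator f hf.bessel) ∘L
      analysisOperator f hf.bessel := by rw [hF, synthesisOperator_eq_adjoint]
  have hpos : 0 ≤ F := by
    rw [ContinuousLinearMap.nonneg_iff_isPositive, hF']
    exact ContinuousLinearMap.isPositive_adjoint_comp_self _
  have hunit : IsUnit F := by
    obtain ⟨C, hC, h⟩ := exists_norm_le_norm_analysisOperator hf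
    refine F.isUnit_of_forall_le_norm_inner_map (c := (Real.toNNReal C ^ 2)⁻¹) (by positivity)
      fun x => ?_
    have h1 : ‖⟪F x, x⟫_ℂ‖ = ‖analysisOperator f hf.bessel x‖ ^ 2 := by
      rw [hF', ContinuousLinearMap.comp_apply, ContinuousLinearMap.adjoint_inner_left,
        inner_self_eq_norm_sq_to_K]
      simp
    rw [h1, NNReal.coe_inv, NNReal.coe_pow, Real.coe_toNNReal _ hC.le,
      mul_inv_le_iff₀ (by positivity), ← mul_pow, mul_comm]
    exact pow_le_pow_left₀ (norm_nonneg _) (h x) 2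
  obtain ⟨b, ⟨b, rfl⟩, hb, hFb⟩ :=
    CStarAlgebra.isStrictlyPositive_iff_exists_isUnit_and_isSelfAdjoint_and_eq_mul_self.1
      (hunit.isStrictlyPositive hpos)
  exact ⟨b, hb, hFb⟩

/-- The estimate `Re ⟨S F y, y⟩ ≥ α ‖F y‖²` with the frame operator `F = T T*`. -/
theorem exists_le_inner_jFrameOperator_frameOperator (hf : K.IsJFrame f) :
    ∃ α : ℝ, 0 < α ∧ ∀ y, α * ‖synthesisOperator f hf.bessel (analysisOperator f hf.bessel y)‖ ^ 2
      ≤ (⟪y, K.jFrameOperator f hf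
          (synthesisOperator f hf.bessel (analysisOperator f hf.bessel y))⟫_ℂ).re := by
  obtain ⟨α, hα, h⟩ := le_form_add_sub_re hf.maximal_pos.prop hf.maximal_neg.prop
  refine ⟨α / 2, by positivity, fun y => ?_⟩
  set T := synthesisOperator f hf.bessel
  set a := analysisOperator f hf.bessel y
  have h1 := h (T (EllTwo.proj (K.indexPos f) a)) ⟨a, rfl⟩ (T (EllTwo.proj (K.indexNeg f) a))
    ⟨a, rfl⟩
  rw [inner_jFrameOperator]
  change _ ≤ (K.form (T a)
    (T (EllTwo.proj (K.indexPos f) a) - T (EllTwo.proj (K.indexNeg f) a))).re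
  have h2 : T (EllTwo.proj (K.indexPos f) a) + T (EllTwo.proj (K.indexNeg f) a) = T a := by
    rw [← map_add, proj_indexPos_add_proj_indexNeg]
  rw [h2] at h1
  refine le_trans ?_ h1
  have h3 : ‖T a‖ ^ 2 ≤ 2 * (‖T (EllTwo.proj (K.indexPos f) a)‖ ^ 2
      + ‖T (EllTwo.proj (K.indexNeg f) a)‖ ^ 2) := by
    rw [← h2]
    exact (pow_le_pow_left₀ (norm_nonneg _) (norm_add_le _ _) 2).trans add_sq_le
  have := mul_le_mul_of_nonneg_left h3 hα.le
  linarith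

/-- The `J`-frame operator is similar to a strictly accretive operator. With `b = F^{1/2}` and
`z = b y`, one has `⟨b⁻¹ S b z, z⟩ = ⟨S F y, y⟩`. -/
theorem exists_conj_jFrameOperator_accretive (hf : K.IsJFrame f) :
    ∃ b : (H →L[ℂ] H)ˣ, ∃ c : ℝ, 0 < c ∧ ∀ z, c * ‖z‖ ^ 2 ≤
      (⟪z, ((↑b⁻¹ : H →L[ℂ] H) * K.jFrameOperator f hf * b) z⟫_ℂ).re := by
  obtain ⟨b, hb, hF⟩ := exists_isUnit_frameOperator_eq_mul_self hf
  obtain ⟨α, hα, h⟩ := exists_le_inner_jFrameOperator_frameOperator hf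
  have hb' : _root_.IsSelfAdjoint (↑b⁻¹ : H →L[ℂ] H) := by
    have hbu : star b = b := Units.ext hb
    rw [isSelfAdjoint_iff, ← Units.coe_star, star_inv, hbu]
  refine ⟨b, α * ((‖(↑b⁻¹ : H →L[ℂ] H)‖ + 1) ^ 2)⁻¹, by positivity, fun z => ?_⟩
  have hFz : synthesisOperator f hf.bessel (analysisOperator f hf.bessel
      ((↑b⁻¹ : H →L[ℂ] H) z)) = (b : H →L[ℂ] H) z := by
    have h0 := congrArg (fun B : H →L[ℂ] H => (B * (↑b⁻¹ : H →L[ℂ] H)) z) hF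
    rwa [mul_assoc, Units.mul_inv, mul_one] at h0
  have h1 := h ((↑b⁻¹ : H →L[ℂ] H) z)
  rw [hFz] at h1
  have h2 := hb'.isSymmetric z (K.jFrameOperator f hf ((b : H →L[ℂ] H) z))
  simp only [ContinuousLinearMap.coe_coe] at h2
  rw [h2] at h1
  refine le_trans ?_ h1
  have h3 : ‖z‖ ≤ (‖(↑b⁻¹ : H →L[ℂ] H)‖ + 1) * ‖(b : H →L[ℂ] H) z‖ := by
    have h4 : (↑b⁻¹ : H →L[ℂ] H) ((b : H →L[ℂ] H) z) = z :=
      congrArg (fun B : H →L[ℂ] H => B z) b.inv_mul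
    calc ‖z‖ = ‖(↑b⁻¹ : H →L[ℂ] H) ((b : H →L[ℂ] H) z)‖ := by rw [h4]
      _ ≤ ‖(↑b⁻¹ : H →L[ℂ] H)‖ * ‖(b : H →L[ℂ] H) z‖ := ContinuousLinearMap.le_opNorm _ _
      _ ≤ _ := by gcongr; linarith
  rw [mul_assoc]
  gcongr
  rw [inv_mul_le_iff₀ (by positivity), ← mul_pow]
  gcongr

end KreinSpace

/-! ### Square roots of accretive operators -/

theorem ContinuousLinearMap.exists_norm_one_sub_smul_lt_one {H : Type*} [NormedAddCommGroup H]
    [InnerProductSpace ℂ H] {A : H →L[ℂ] H} {c : ℝ} (hc : 0 < c)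
    (h : ∀ z, c * ‖z‖ ^ 2 ≤ (⟪z, A z⟫_ℂ).re) :
    ∃ r : ℝ, 0 < r ∧ ‖1 - (r : ℂ) • A‖ < 1 := by
  set M := ‖A‖ + c
  have hM : 0 < M := by positivity
  set r : ℝ := c / M ^ 2 with hr
  have hr0 : 0 < r := by positivity
  -- The bound `‖z - r A z‖² ≤ (1 - 2 r c + r² M²) ‖z‖²` is sharpest for this `r`.
  have hrM : r * M ^ 2 = c := by rw [hr]; field_simp
  have hrc : r * c ≤ 1 := by
    have : c ≤ M := le_add_of_nonneg_left (norm_nonneg _)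
    rw [hr, div_mul_eq_mul_div, div_le_one₀ (by positivity), ← pow_two]
    exact pow_le_pow_left₀ hc.le this 2
  refine ⟨r, hr0, lt_of_le_of_lt (ContinuousLinearMap.opNorm_le_bound _
    (Real.sqrt_nonneg (1 - r * c)) fun z => ?_) ?_⟩
  · refine le_of_sq_le_sq ?_ (by positivity)
    have h1 : ‖A z‖ ^ 2 ≤ M ^ 2 * ‖z‖ ^ 2 := by
      rw [← mul_pow]
      refine pow_le_pow_left₀ (norm_nonneg _) ((A.le_opNorm z).trans ?_) 2
      gcongr
      exact le_add_of_nonneg_right hc.le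
    have h2 : ‖z - (r : ℂ) • A z‖ ^ 2
        = ‖z‖ ^ 2 - 2 * (r * (⟪z, A z⟫_ℂ).re) + r ^ 2 * ‖A z‖ ^ 2 := by
      rw [norm_sub_sq (𝕜 := ℂ), inner_smul_right, norm_smul, mul_pow, Complex.norm_real,
        Real.norm_eq_abs, sq_abs, RCLike.re_to_complex, Complex.re_ofReal_mul]
    have h3 := mul_le_mul_of_nonneg_left (h z) hr0.le
    have h4 := mul_le_mul_of_nonneg_left h1 (sq_nonneg r)
    have h5 : r ^ 2 * (M ^ 2 * ‖z‖ ^ 2) = r * c * ‖z‖ ^ 2 := by rw [← hrM]; ring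
    rw [mul_pow, Real.sq_sqrt (by linarith)]
    change ‖z - (r : ℂ) • A z‖ ^ 2 ≤ _
    linarith
  · rw [Real.sqrt_lt' one_pos]; nlinarith [mul_pos hr0 hc]

/-- If `r b⁻¹ s b` has distance less than one from the identity and `q` is its square root, then
`r^{-1/2} b q b⁻¹` is a square root of `s`. -/
theorem exists_sq_eq_spectrum_subset_openSector {A : Type*} [NormedRing A] [NormedAlgebra ℂ A]
    [CompleteSpace A] [NormOneClass A] {s : A} {b : Aˣ} {r : ℝ} (hr : 0 < r)
    (h : ‖1 - (r : ℂ) • (↑b⁻¹ * s * b)‖ < 1) :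
    ∃ p : A, p ^ 2 = s ∧ spectrum ℂ p ⊆ openSector := by
  have : Nontrivial A := NormOneClass.nontrivial
  obtain ⟨q, hq, hq1⟩ := exists_sq_eq_of_norm_one_sub_lt_one h
  have ht : 0 < √r := Real.sqrt_pos.2 hr
  have ht0 : ((√r : ℝ) : ℂ) ≠ 0 := by exact_mod_cast ht.ne'
  have htr : ((√r : ℝ) : ℂ) ^ 2 = r := by exact_mod_cast Real.sq_sqrt hr.le
  set t : ℂˣ := Units.mk0 _ ht0 with ht_def
  have htr' : ((t : ℂ) ^ 2) = r := htr
  have hp2 : (t⁻¹ • (↑b * q * ↑b⁻¹)) ^ 2 = s := by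
    have h1 : (↑b * q * ↑b⁻¹) ^ 2 = ↑b * q ^ 2 * (↑b⁻¹ : A) := by
      simp only [pow_two, mul_assoc, Units.inv_mul_cancel_left]
    have h2 : (↑b * q * ↑b⁻¹) ^ 2 = t ^ 2 • s := by
      rw [h1, hq, Units.smul_def, Units.val_pow_eq_pow_val, htr', mul_smul_comm, smul_mul_assoc]
      simp only [mul_assoc, Units.mul_inv_cancel_left, Units.mul_inv, mul_one]
    rw [smul_pow, h2, inv_pow, inv_smul_smul]
  refine ⟨t⁻¹ • (↑b * q * ↑b⁻¹), hp2, fun z hz => ?_⟩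
  have hz2 : z ^ 2 ∈ spectrum ℂ s := by
    rw [← hp2]
    exact spectrum.pow_mem_pow _ 2 hz
  have hsr : (r : ℂ) * z ^ 2 ∈ spectrum ℂ ((r : ℂ) • (↑b⁻¹ * s * b)) := by
    have h1 : t ^ 2 • z ^ 2 ∈ spectrum ℂ (t ^ 2 • (↑b⁻¹ * s * b)) := by
      rw [spectrum.smul_mem_smul_iff, spectrum.units_conjugate']
      exact hz2
    simpa only [Units.smul_def, Units.val_pow_eq_pow_val, htr', smul_eq_mul] using h1
  have hq' : (t : ℂ) * z ∈ spectrum ℂ q := by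
    have h1 : t • z ∈ spectrum ℂ (t • t⁻¹ • (↑b * q * ↑b⁻¹)) :=
      spectrum.smul_mem_smul_iff.2 hz
    rwa [smul_inv_smul, spectrum.units_conjugate] at h1
  have h1 := re_pos_of_mem_spectrum_of_norm_one_sub_lt_one h hsr
  have h2 := re_pos_of_mem_spectrum_of_norm_one_sub_lt_one hq1 hq'
  rw [Complex.re_ofReal_mul] at h1
  rw [ht_def, Units.val_mk0, Complex.re_ofReal_mul] at h2
  exact mem_openSector_iff.2 ⟨pos_of_mul_pos_right h2 ht.le, pos_of_mul_pos_right h1 hr.le⟩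

/-! ### Self-adjointness of the square root -/

/-- The Krein space adjoint `J P* J` of `P` is a root of the same operator, with the conjugate
spectrum, so it agrees with `P` by uniqueness. -/
theorem KreinSpace.isSelfAdjoint_of_sq_eq {H : Type*} [NormedAddCommGroup H]
    [InnerProductSpace ℂ H] [CompleteSpace H] [Nontrivial H] {K : KreinSpace H} {S P : H →L[ℂ] H}
    (hS : K.IsSelfAdjoint S) (hP : P ^ 2 = S) (hσ : spectrum ℂ P ⊆ openSector) :
    K.IsSelfAdjoint P := by
  obtain ⟨J, hJsa, hJJ, hJ⟩ := K.exists_fundamentalSymmetry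
  have hJsym : ∀ x y, ⟪J x, y⟫_ℂ = ⟪x, J y⟫_ℂ := hJsa.isSymmetric
  have hJS : J * S = star S * J := by
    ext x
    refine ext_inner_left ℂ fun y => ?_
    change ⟪y, J (S x)⟫_ℂ = ⟪y, ContinuousLinearMap.adjoint S (J x)⟫_ℂ
    rw [ContinuousLinearMap.adjoint_inner_right, ← hJ, ← hJ, hS]
  let j : (H →L[ℂ] H)ˣ := ⟨J, J, hJJ, hJJ⟩
  have hspec : spectrum ℂ (J * star P * J) = spectrum ℂ (star P) :=
    spectrum.units_conjugate (u := j)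
  have hsq : (J * star P * J) ^ 2 = P ^ 2 := by
    calc (J * star P * J) ^ 2 = J * star P * (J * J) * star P * J := by
          simp only [pow_two, mul_assoc]
      _ = J * star (P ^ 2) * J := by rw [hJJ, mul_one, star_pow]; simp only [pow_two, mul_assoc]
      _ = P ^ 2 := by rw [hP, mul_assoc, ← hJS, ← mul_assoc, hJJ, one_mul]
  have hadj : J * star P * J = P := by
    refine eq_of_sq_eq_sq_of_spectrum_re_pos (fun z hz => ?_)
      (fun z hz => (mem_openSector_iff.1 (hσ hz)).1) hsq
    rw [hspec, spectrum.map_star, Set.mem_star] at hz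
    simpa using (mem_openSector_iff.1 (hσ hz)).1
  have hJP : ∀ x, J (P x) = ContinuousLinearMap.adjoint P (J x) := fun x => by
    have h1 : J * P = star P * J := by
      rw [← hadj, ← mul_assoc, ← mul_assoc, hJJ, one_mul, hadj]
    exact congrArg (fun B : H →L[ℂ] H => B x) h1
  intro x y
  rw [hJ, hJ, hJP, ContinuousLinearMap.adjoint_inner_right]

theorem theorem6p1 {H : Type*} [NormedAddCommGroup H] [InnerProductSpace ℂ H] [CompleteSpace H]
    (K : KreinSpace H) {ι : Type*} (f : ι → H) (hf : K.IsJFrame f) :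
    (∃! P : H →L[ℂ] H, P ^ 2 = K.jFrameOperator f hf ∧ spectrum ℂ P ⊆ openSector) ∧
    ∀ P : H →L[ℂ] H, P ^ 2 = K.jFrameOperator f hf → spectrum ℂ P ⊆ openSector →
      K.IsSelfAdjoint P := by
  -- On the zero space the spectrum is empty and the only operator is `0`.
  rcases subsingleton_or_nontrivial H with hH | hH
  · refine ⟨⟨0, ⟨Subsingleton.elim _ _, by simp⟩, fun _ _ => Subsingleton.elim _ _⟩,
      fun P _ _ x y => ?_⟩
    rw [Subsingleton.elim x 0, Subsingleton.elim y 0]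
    simp
  refine ⟨?_, fun P hP hσ =>
    KreinSpace.isSelfAdjoint_of_sq_eq (KreinSpace.isSelfAdjoint_jFrameOperator hf) hP hσ⟩
  obtain ⟨b, c, hc, hacc⟩ := KreinSpace.exists_conj_jFrameOperator_accretive hf
  obtain ⟨r, hr, hnorm⟩ := ContinuousLinearMap.exists_norm_one_sub_smul_lt_one hc hacc
  obtain ⟨P, hP, hσ⟩ := exists_sq_eq_spectrum_subset_openSector hr hnorm
  refine ⟨P, ⟨hP, hσ⟩, fun Q hQ => ?_⟩
  exact eq_of_sq_eq_sq_of_spectrum_re_pos (fun z hz => (mem_openSector_iff.1 (hQ.2 hz)).1)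
    (fun z hz => (mem_openSector_iff.1 (hσ hz)).1) (hQ.1.trans hP.symm)
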